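/- **Theorem.** Let $n\ge 1$ and let $\alpha,\beta$ be real numbers with $0<\alpha<n$ and $\alpha<\beta$. For $0<\delta\le 1$ put $$M_\delta f=\big(M(|f|^\delta)\big)^{1/\delta},\qquad M g(x)=\sup_{Q\ni x}\frac1{|Q|}\int_Q|g|,$$ the supremum being over all cubes $Q\subset\mathbb R^n$ with sides parallel to the axes that contain $x$. For $k\ge 1$ let $\phi_*:\mathbb R\to\mathbb R$ and $\phi:\mathbb R\to\mathbb R$ be any functions such that $\phi_*(x)=\ln^{(k)}|\ln x|$ (the $k$-fold iterated logarithm applied to $|\ln x|$) for all sufficiently large $x$, and $\phi(x)=-x\,\frac{d}{dx}\ln^{(k)}|\ln x|$ for all sufficiently small $x>0$. For $\eta>0$ let $\widetilde{bmo}_\phi$ be the space of functions $g$ with $$\|g\|_{\widetilde{bmo}_\phi}=\|g\|_{L^1}+\sup_{|Q|<\eta}\frac1{\phi(r)}\,\frac{1}{|Q|}\int_Q|g-g(Q)|\,dx<\infty,$$ where $r$ is the side length of the cube $Q$ and $g(Q)=\frac1{|Q|}\int_Q g$. There exists a single compactly supported function $f:\mathbb R^n\to\mathbb R$, of class $C^1$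 on $\mathbb R^n\setminus\{0\}$ and belonging to $L^p(\mathbb R^n)$ for every $1\le p<n/\alpha$, such that for some constants $c,C,\rho_0>0$ $$c\,|x|^{-\alpha}\le |f(x)|\le C\,|x|^{-\beta}\qquad(0<|x|<\rho_0),$$ but for every $\delta\in(0,1]$, every $k\ge1$, every $\phi_*,\phi$ as above, and every $\eta>0$, $$\phi_*(M_\delta f)\notin\widetilde{bmo}_\phi .$$ Moreover, the failure is due to the mean oscillation at the origin and not to the $L^1$ norm: $\phi_*(M_\delta f)$ is integrable on some ball centred at $0$, while for every $\rho>0$ and $\eta>0$ $$\sup_{Q\subset B(0,\rho),\ |Q|<\eta}\frac1{\phi(r)}\,\frac1{|Q|}\int_Q\big|\phi_*(M_\delta f)-\phi_*(M_\delta f)(Q)\big|\,dx=\infty .$$ -/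

import Mathlib

open MeasureTheory Filter Topology
open scoped ENNReal

namespace WeightedBMO

/-- Closed cube in `ℝⁿ` with sides parallel to the axes, centre `c` and side length `r`. -/
def cube {n : ℕ} (c : EuclideanSpace ℝ (Fin n)) (r : ℝ) : Set (EuclideanSpace ℝ (Fin n)) :=
  {x | ∀ i, |x i - c i| ≤ r / 2}

/-- The (uncentred, cubic) maximal function
`M(|f|^δ)(x) = sup_{Q ∋ x} |Q|⁻¹ ∫_Q |f|^δ`, with values in `[0, ∞]`. -/
noncomputable def maximalPow {n : ℕ} (δ : ℝ) (f : EuclideanSpace ℝ (Fin n) → ℝ)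
    (x : EuclideanSpace ℝ (Fin n)) : ℝ≥0∞ :=
  ⨆ (c : EuclideanSpace ℝ (Fin n)) (r : ℝ) (_ : 0 < r) (_ : x ∈ cube c r),
    ⨍⁻ y in cube c r, ‖f y‖ₑ ^ δ ∂volume

/-- `M_δ f = (M(|f|^δ))^{1/δ}`, as a real-valued function. -/
noncomputable def maximal {n : ℕ} (δ : ℝ) (f : EuclideanSpace ℝ (Fin n) → ℝ)
    (x : EuclideanSpace ℝ (Fin n)) : ℝ :=
  (maximalPow δ f x ^ (1 / δ)).toReal

/-- `sup (1 / φ(r)) ⨍_Q |g - g(Q)|` over the cubes `Q ⊆ U` with `|Q| < η`, where `r` is the side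
length of `Q` and `g(Q)` the mean value of `g` on `Q`. -/
noncomputable def oscSup {n : ℕ} (φ : ℝ → ℝ) (η : ℝ) (U : Set (EuclideanSpace ℝ (Fin n)))
    (g : EuclideanSpace ℝ (Fin n) → ℝ) : ℝ≥0∞ :=
  ⨆ (c : EuclideanSpace ℝ (Fin n)) (r : ℝ) (_ : 0 < r) (_ : cube c r ⊆ U)
    (_ : volume (cube c r) < ENNReal.ofReal η),
    (⨍⁻ x in cube c r, ‖g x - ⨍ y in cube c r, g y ∂volume‖ₑ ∂volume) / ENNReal.ofReal (φ r)

/-- The norm `‖g‖_{L¹} + sup_{|Q| < η} (1 / φ(r)) ⨍_Q |g - g(Q)|`. -/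
noncomputable def bmoNorm {n : ℕ} (φ : ℝ → ℝ) (η : ℝ)
    (g : EuclideanSpace ℝ (Fin n) → ℝ) : ℝ≥0∞ :=
  eLpNorm g 1 volume + oscSup φ η Set.univ g

/-- Membership in the weighted local space `bmo_φ` (with cube size bound `η`). -/
def MemBmo {n : ℕ} (φ : ℝ → ℝ) (η : ℝ) (g : EuclideanSpace ℝ (Fin n) → ℝ) : Prop :=
  AEStronglyMeasurable g volume ∧ bmoNorm φ η g < ⊤

/-- `ln^{(k)} |ln x|`, the logarithm iterated `k` times applied to `|ln x|`. -/
noncomputable def iterLog (k : ℕ) (x : ℝ) : ℝ :=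
  Real.log^[k] |Real.log x|

end WeightedBMO

/-! The function is `|x|^(-α)` plus extremely narrow spikes of height `|x|^(-β)`, placed at
distances `r = 8^(-(j+1))` from the origin and cut off away from it. The weight is small at small
scales: `φ(s) ≤ 1 / |ln s|`. Take a cube of side `R = exp(-exp(1/r))` centred at a spike, so that
`φ(R) ≤ exp(-1/r)`, and give the spike a radius `σ` comparable to `R r^β`.

On the spike `M_δ f` is at least about `r^(-β)`. At distance about `R/4` from it, `M_δ f ≤ C r^(-γ)`
for a fixed `γ` with `α < γ < β` (`exists_maximalPow_rpow_le_of_dist_spike`): a small cube that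
reaches the spike is so large compared with `σ` that the spike adds only a bounded amount to the
average, and large cubes are controlled by the `L^p` norm with `p = n/γ`. The logarithm turns the
two different powers into a gap, and the iterated logarithms shrink that gap only to a power of `r`
(`eventually_rpow_le_iterate_log_sub`). The subcubes on which the two bounds hold fill a fraction of
order `r^(βn)` of the cube.

The mean oscillation is therefore at least a power of `r`, and dividing by `φ(R)` multiplies it by
at least `exp(1/r)`, which is unbounded as `r → 0` (`le_oscSup`, `oscSup_eq_top`). The spikes are so
thin that they cost nothing in any `L^p` (`memLp_bump_mul_spikes`), and a crude power bound on `M_δ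
f` gives local integrability after taking logarithms (`integrableOn_comp_maximal`). -/

namespace WeightedBMO

/-! ### Geometry and volume of cubes. -/

section Cube

variable {n : ℕ}

lemma cube_eq_preimage (c : EuclideanSpace ℝ (Fin n)) (r : ℝ) :
    cube c r = (@WithLp.ofLp 2 (Fin n → ℝ)) ⁻¹'
      Set.Icc (fun i => c i - r / 2) (fun i => c i + r / 2) := by
  ext x
  simp only [cube, Set.mem_ofPred_eq, Set.mem_preimage, Set.mem_Icc, Pi.le_def, abs_le]
  constructor
  · intro h
    exact ⟨fun i => by linarith [(h i).1], fun i => by linarith [(h i).2]⟩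
  · intro h i
    exact ⟨by linarith [h.1 i], by linarith [h.2 i]⟩

lemma measurableSet_cube (c : EuclideanSpace ℝ (Fin n)) (r : ℝ) : MeasurableSet (cube c r) := by
  rw [cube_eq_preimage]
  exact (PiLp.volume_preserving_ofLp (Fin n)).measurable measurableSet_Icc

lemma volume_cube (c : EuclideanSpace ℝ (Fin n)) (r : ℝ) :
    volume (cube c r) = ENNReal.ofReal r ^ n := by
  rw [cube_eq_preimage, (PiLp.volume_preserving_ofLp (Fin n)).measure_preimage
    measurableSet_Icc.nullMeasurableSet, Real.volume_Icc_pi]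
  simp

lemma volume_cube_ne_zero (c : EuclideanSpace ℝ (Fin n)) {r : ℝ} (hr : 0 < r) :
    volume (cube c r) ≠ 0 := by
  rw [volume_cube]
  exact pow_ne_zero _ (by simpa using hr)

lemma volume_cube_ne_top (c : EuclideanSpace ℝ (Fin n)) (r : ℝ) :
    volume (cube c r) ≠ ⊤ := by
  rw [volume_cube]
  finiteness

lemma mem_cube_self (c : EuclideanSpace ℝ (Fin n)) {r : ℝ} (hr : 0 ≤ r) : c ∈ cube c r := by
  intro i
  simp only [sub_self, abs_zero]
  positivity

lemma norm_le_of_forall_abs_le (x : EuclideanSpace ℝ (Fin n)) {a : ℝ} (ha : 0 ≤ a)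
    (h : ∀ i, |x i| ≤ a) : ‖x‖ ≤ n * a := by
  rw [EuclideanSpace.norm_eq]
  apply Real.sqrt_le_iff.2 ⟨by positivity, _⟩
  calc ∑ i, ‖x i‖ ^ 2 ≤ ∑ _i : Fin n, a ^ 2 :=
        Finset.sum_le_sum fun i _ => pow_le_pow_left₀ (norm_nonneg _) (h i) 2
    _ = n * a ^ 2 := by simp
    _ ≤ (n : ℝ) ^ 2 * a ^ 2 := by
        gcongr
        exact_mod_cast Nat.le_self_pow two_ne_zero n
    _ = (n * a) ^ 2 := by ring

lemma abs_apply_le_norm (x : EuclideanSpace ℝ (Fin n)) (i : Fin n) : |x i| ≤ ‖x‖ :=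
  PiLp.norm_apply_le x i

lemma norm_sub_le_of_mem_cube {c x : EuclideanSpace ℝ (Fin n)} {r : ℝ} (hr : 0 ≤ r)
    (hx : x ∈ cube c r) : ‖x - c‖ ≤ n * (r / 2) :=
  norm_le_of_forall_abs_le _ (by positivity) hx

lemma abs_sub_le_of_mem_cube {c x y : EuclideanSpace ℝ (Fin n)} {r : ℝ}
    (hx : x ∈ cube c r) (hy : y ∈ cube c r) (i : Fin n) : |x i - y i| ≤ r := by
  have h1 := abs_le.1 (hx i)
  have h2 := abs_le.1 (hy i)
  rw [abs_le]
  constructor <;> linarith [h1.1, h1.2, h2.1, h2.2]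

lemma norm_sub_le_of_mem_cube_of_mem_cube {c x y : EuclideanSpace ℝ (Fin n)} {r : ℝ}
    (hr : 0 ≤ r) (hx : x ∈ cube c r) (hy : y ∈ cube c r) : ‖x - y‖ ≤ n * r :=
  norm_le_of_forall_abs_le _ hr fun i => abs_sub_le_of_mem_cube hx hy i

lemma ball_subset_cube (c : EuclideanSpace ℝ (Fin n)) (r : ℝ) :
    Metric.ball c r ⊆ cube c (2 * r) := by
  intro x hx i
  rw [Metric.mem_ball, dist_eq_norm] at hx
  have := abs_apply_le_norm (x - c) i
  rw [PiLp.sub_apply] at this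
  linarith

end Cube

/-! ### General bounds for the maximal function and the mean oscillation. -/

section Maximal

variable {n : ℕ} {δ : ℝ} {f : EuclideanSpace ℝ (Fin n) → ℝ} {x : EuclideanSpace ℝ (Fin n)}

/-- The maximal function is lower semicontinuous, because a cube can be enlarged slightly without
changing the average much. -/
lemma lowerSemicontinuous_maximalPow (δ : ℝ) (f : EuclideanSpace ℝ (Fin n) → ℝ) :
    LowerSemicontinuous (maximalPow δ f) := by
  intro x l hl
  simp only [maximalPow, lt_iSup_iff] at hl
  obtain ⟨c, r, hr, hx, h⟩ := hl
  rw [setLAverage_eq, volume_cube] at h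
  set I := ∫⁻ y in cube c r, ‖f y‖ₑ ^ δ with hI
  have ht : Tendsto (fun s : ℝ => I / ENNReal.ofReal s ^ n) (𝓝[>] r)
      (𝓝 (I / ENNReal.ofReal r ^ n)) := by
    refine ENNReal.Tendsto.const_div ?_ (Or.inl (by finiteness))
    exact ((ENNReal.continuous_pow n).comp ENNReal.continuous_ofReal).continuousAt.tendsto.mono_left
      nhdsWithin_le_nhds
  obtain ⟨s, hs, hrs⟩ := ((ht.eventually (lt_mem_nhds h)).and self_mem_nhdsWithin).exists
  replace hrs : r < s := hrs
  have hs0 : 0 < s := hr.trans hrs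
  filter_upwards [Metric.ball_mem_nhds x (half_pos (sub_pos.2 hrs))] with y hy
  have hyc : y ∈ cube c s := by
    intro i
    have h1 := ball_subset_cube _ _ hy i
    have h2 := hx i
    have := abs_sub_le (y i) (x i) (c i)
    linarith
  refine hs.trans_le ?_
  refine le_trans ?_ (le_iSup₂_of_le c s <| le_iSup₂_of_le hs0 hyc le_rfl)
  rw [setLAverage_eq, volume_cube]
  gcongr
  refine lintegral_mono_set fun z hz i => (hz i).trans (by linarith)

lemma measurable_maximal (δ : ℝ) (f : EuclideanSpace ℝ (Fin n) → ℝ) :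
    Measurable (maximal δ f) :=
  ((lowerSemicontinuous_maximalPow δ f).measurable.pow_const _).ennreal_toReal

lemma ofReal_le_maximalPow_rpow (hδ : 0 < δ) {c : EuclideanSpace ℝ (Fin n)} {r K : ℝ}
    (hr : 0 < r) (hx : x ∈ cube c r) (hf : ∀ y ∈ cube c r, K ≤ f y) :
    ENNReal.ofReal K ≤ maximalPow δ f x ^ (1 / δ) := by
  rw [← ENNReal.rpow_le_rpow_iff hδ, ← ENNReal.rpow_mul, one_div_mul_cancel hδ.ne',
    ENNReal.rpow_one]
  refine le_trans ?_ (le_iSup₂_of_le c r <| le_iSup₂_of_le hr hx le_rfl)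
  rw [← setLAverage_const (volume_cube_ne_zero c hr) (volume_cube_ne_top c r)
    (ENNReal.ofReal K ^ δ), setLAverage_eq, setLAverage_eq]
  gcongr 1
  refine setLIntegral_mono' (measurableSet_cube c r) fun y hy => ?_
  gcongr
  exact (ENNReal.ofReal_le_ofReal ((hf y hy).trans (le_abs_self _))).trans_eq
    (Real.enorm_eq_ofReal_abs _).symm

/-- By Jensen's inequality `M_δ f` is controlled by averages of `|f|^p` with `p ≥ δ`. -/
lemma maximalPow_rpow_le (hδ : 0 < δ) (hf : AEStronglyMeasurable f volume) {K : ℝ≥0∞}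
    (h : ∀ c r, 0 < r → x ∈ cube c r →
      ∃ p : ℝ, δ ≤ p ∧ (⨍⁻ y in cube c r, ‖f y‖ₑ ^ p ∂volume) ^ (1 / p) ≤ K) :
    maximalPow δ f x ^ (1 / δ) ≤ K := by
  rw [← ENNReal.rpow_le_rpow_iff hδ, ← ENNReal.rpow_mul, one_div_mul_cancel hδ.ne',
    ENNReal.rpow_one]
  refine iSup₂_le fun c r => iSup₂_le fun hr hx => ?_
  obtain ⟨p, hp, hK⟩ := h c r hr hx
  have hv0 := volume_cube_ne_zero c hr
  have hv1 := volume_cube_ne_top c r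
  set ν : Measure (EuclideanSpace ℝ (Fin n)) := (volume (cube c r))⁻¹ • volume.restrict (cube c r)
    with hν
  have : IsProbabilityMeasure ν := ⟨by simp [hν, ENNReal.inv_mul_cancel hv0 hv1]⟩
  have hm := eLpNorm'_le_eLpNorm'_of_exponent_le hδ hp ν (f := f)
    (hf.restrict.smul_measure _)
  simp only [eLpNorm', hν, ← setLAverage_eq'] at hm
  have := hm.trans hK
  rwa [← ENNReal.rpow_le_rpow_iff hδ, ← ENNReal.rpow_mul, one_div_mul_cancel hδ.ne',
    ENNReal.rpow_one] at this

/-- Handles the large cubes: enlarging the domain of integration to the whole space leaves only the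
factor `|Q|^(-1/p)`, which decreases with the side length. -/
lemma setLAverage_rpow_le_eLpNorm {p : ℝ} (hp : 0 < p) (c : EuclideanSpace ℝ (Fin n)) {r l : ℝ}
    (hl : 0 < l) (hlr : l ≤ r) :
    (⨍⁻ y in cube c r, ‖f y‖ₑ ^ p ∂volume) ^ (1 / p) ≤
      eLpNorm f (ENNReal.ofReal p) volume * ENNReal.ofReal (l ^ (-(n / p : ℝ))) := by
  rw [setLAverage_eq, volume_cube, ENNReal.div_eq_inv_mul, ENNReal.mul_rpow_of_nonneg _ _
    (by positivity), mul_comm, eLpNorm_eq_lintegral_rpow_enorm_toReal (by simpa using hp)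
    ENNReal.ofReal_ne_top, ENNReal.toReal_ofReal hp.le]
  gcongr
  · exact Measure.restrict_le_self
  · rw [ENNReal.inv_rpow, ← ENNReal.rpow_natCast, ← ENNReal.rpow_mul, ← ENNReal.rpow_neg,
      Real.rpow_neg hl.le, ENNReal.ofReal_inv_of_pos (by positivity), ENNReal.rpow_neg,
      mul_one_div, ← ENNReal.ofReal_rpow_of_pos hl]
    gcongr

/-- Whatever the mean `m` is, it lies on one side of `(a + b) / 2`, so on at least one of the two
subcubes `g` differs from `m` by `(a - b) / 2` or more. Nothing about `m` beyond its being a real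
number enters, so `g` need not be integrable. -/
lemma le_oscSup {φ : ℝ → ℝ} {η : ℝ} {U : Set (EuclideanSpace ℝ (Fin n))}
    {g : EuclideanSpace ℝ (Fin n) → ℝ} {c c₁ c₂ : EuclideanSpace ℝ (Fin n)} {r s a b : ℝ}
    (hr : 0 < r) (hU : cube c r ⊆ U) (hη : volume (cube c r) < ENNReal.ofReal η)
    (h₁ : cube c₁ s ⊆ cube c r) (h₂ : cube c₂ s ⊆ cube c r)
    (ha : ∀ x ∈ cube c₁ s, a ≤ g x) (hb : ∀ x ∈ cube c₂ s, g x ≤ b) :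
    ENNReal.ofReal ((a - b) / 2) * ENNReal.ofReal s ^ n / ENNReal.ofReal r ^ n
      / ENNReal.ofReal (φ r) ≤ oscSup φ η U g := by
  refine le_trans ?_ (le_iSup₂_of_le c r <| le_iSup₂_of_le hr hU <| le_iSup_of_le hη le_rfl)
  rw [setLAverage_eq, volume_cube]
  gcongr
  set m := ⨍ y in cube c r, g y
  have key : ∀ c', cube c' s ⊆ cube c r →
      (∀ x ∈ cube c' s, (a - b) / 2 ≤ |g x - m|) →
      ENNReal.ofReal ((a - b) / 2) * ENNReal.ofReal s ^ n
        ≤ ∫⁻ x in cube c r, ‖g x - m‖ₑ := by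
    intro c' hc' h
    calc ENNReal.ofReal ((a - b) / 2) * ENNReal.ofReal s ^ n
        = ∫⁻ x in cube c' s, ENNReal.ofReal ((a - b) / 2) := by
          rw [setLIntegral_const, volume_cube]
      _ ≤ ∫⁻ x in cube c' s, ‖g x - m‖ₑ := by
          refine setLIntegral_mono' (measurableSet_cube _ _) fun x hx => ?_
          rw [Real.enorm_eq_ofReal_abs]
          exact ENNReal.ofReal_le_ofReal (h x hx)
      _ ≤ _ := lintegral_mono_set hc'
  rcases le_total m ((a + b) / 2) with hm | hm
  · refine key c₁ h₁ fun x hx => le_trans ?_ (le_abs_self _)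
    linarith [ha x hx]
  · refine key c₂ h₂ fun x hx => le_trans ?_ (neg_le_abs _)
    linarith [hb x hx]

lemma oscSup_mono (φ : ℝ → ℝ) (η : ℝ) {U V : Set (EuclideanSpace ℝ (Fin n))} (h : U ⊆ V)
    (g : EuclideanSpace ℝ (Fin n) → ℝ) : oscSup φ η U g ≤ oscSup φ η V g :=
  iSup₂_mono fun _ _ => iSup_mono fun _ => iSup_mono' fun hU => ⟨hU.trans h, le_rfl⟩

end Maximal

/-! ### Iterated logarithms: quantitative monotonicity and the size of the weight. -/

section IteratedLog

lemma tendsto_iterate_log_atTop (k : ℕ) : Tendsto (Real.log^[k]) atTop atTop :=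
  Tendsto.iterate Real.tendsto_log_atTop k

lemma measurable_iterate_log (k : ℕ) : Measurable (Real.log^[k]) :=
  Real.measurable_log.iterate k

lemma eventually_one_le_iterate_log_le (k : ℕ) :
    ∀ᶠ y : ℝ in atTop, 1 ≤ Real.log^[k] y ∧ Real.log^[k] y ≤ y := by
  induction k with
  | zero => filter_upwards [eventually_ge_atTop 1] with y hy using ⟨hy, le_rfl⟩
  | succ k ih =>
    filter_upwards [ih, (tendsto_iterate_log_atTop (k + 1)).eventually_ge_atTop 1] with y hy h1
    refine ⟨h1, ?_⟩
    rw [Function.iterate_succ_apply']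
    exact (Real.log_le_self (by linarith)).trans hy.2

/-- Each further logarithm satisfies `log u - log v ≥ (u - v) / u`, which is `log t ≤ t - 1` at `t =
v / u`. Since `u = log^[k] x ≤ x`, it costs at most one factor `x`, whence `x ^ k`. -/
lemma eventually_le_iterate_log_sub (k : ℕ) :
    ∀ᶠ y : ℝ in atTop, ∀ x, y ≤ x → (x - y) / x ^ k ≤ Real.log^[k] x - Real.log^[k] y := by
  induction k with
  | zero => exact Eventually.of_forall fun y x _ => by simp
  | succ k ih =>
    have h := eventually_forall_ge_atTop.2 (eventually_one_le_iterate_log_le k)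
    filter_upwards [ih, h, eventually_ge_atTop 1] with y ih h hy x hyx
    obtain ⟨hv, -⟩ := h y le_rfl
    obtain ⟨hu, hux⟩ := h x hyx
    have hx : 0 < x := by linarith
    rw [Function.iterate_succ_apply', Function.iterate_succ_apply']
    set u := Real.log^[k] x
    set v := Real.log^[k] y
    have huv : 0 ≤ u - v := le_trans (div_nonneg (by linarith) (by positivity)) (ih x hyx)
    have hlog : (u - v) / u ≤ Real.log u - Real.log v := by
      have h1 := Real.log_le_sub_one_of_pos (x := v / u) (by positivity)
      rw [Real.log_div (by positivity) (by positivity)] at h1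
      have : (u - v) / u = 1 - v / u := by field_simp
      linarith
    calc (x - y) / x ^ (k + 1) = (x - y) / x ^ k / x := by rw [pow_succ, div_div]
      _ ≤ (u - v) / x := by gcongr; exact ih x hyx
      _ ≤ (u - v) / u := by gcongr
      _ ≤ _ := hlog

lemma eventually_iterate_log_mono (k : ℕ) :
    ∀ᶠ y : ℝ in atTop, ∀ x, y ≤ x → Real.log^[k] y ≤ Real.log^[k] x := by
  filter_upwards [eventually_le_iterate_log_sub k, eventually_ge_atTop 1] with y h hy x hyx
  have : 0 ≤ (x - y) / x ^ k := div_nonneg (by linarith) (pow_nonneg (by linarith) _)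
  linarith [h x hyx]

/-- By the chain rule every logarithm after the first divides the derivative by a quantity that is
eventually at least `1`; these factors are discarded and only `1 / y` is kept. -/
lemma eventually_hasDerivAt_iterate_log (k : ℕ) :
    ∀ᶠ y : ℝ in atTop, ∃ d, 0 ≤ d ∧ d ≤ y⁻¹ ∧ HasDerivAt (Real.log^[k + 1]) d y := by
  induction k with
  | zero =>
    filter_upwards [eventually_ge_atTop 1] with y hy
    exact ⟨y⁻¹, by positivity, le_rfl, Real.hasDerivAt_log (by positivity)⟩
  | succ k ih =>
    filter_upwards [ih, eventually_one_le_iterate_log_le (k + 1)] with y ⟨d, hd0, hd, h⟩ ⟨h1, _⟩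
    refine ⟨d / Real.log^[k + 1] y, by positivity, (div_le_self hd0 h1).trans hd, ?_⟩
    rw [Function.iterate_succ']
    exact h.log (by positivity)

/-- Near `0` the factor `-x` cancels the inner derivative of `-log x`, leaving the derivative of
`log^[k]` at `-log x`. -/
lemma eventually_neg_mul_deriv_iterLog_le {k : ℕ} (hk : 1 ≤ k) :
    ∀ᶠ x : ℝ in 𝓝[>] 0, -x * deriv (iterLog k) x ≤ |Real.log x|⁻¹ := by
  obtain ⟨k, rfl⟩ := Nat.exists_eq_add_of_le' hk
  have hlog : Tendsto (fun x => -Real.log x) (𝓝[>] 0) atTop :=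
    tendsto_neg_atBot_atTop.comp Real.tendsto_log_nhdsGT_zero
  filter_upwards [hlog.eventually (eventually_hasDerivAt_iterate_log k), self_mem_nhdsWithin,
    mem_nhdsWithin_of_mem_nhds (gt_mem_nhds one_pos)] with x ⟨d, hd0, hd, h⟩ hx hx1
  replace hx : 0 < x := hx
  have habs : ∀ y ∈ Set.Ioo (0 : ℝ) 1, |Real.log y| = -Real.log y := fun y hy =>
    abs_of_neg (Real.log_neg hy.1 hy.2)
  have hev : iterLog (k + 1) =ᶠ[𝓝 x] fun y => Real.log^[k + 1] (-Real.log y) := by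
    filter_upwards [Ioo_mem_nhds hx hx1] with y hy
    rw [iterLog, habs y hy]
  have hcomp : HasDerivAt (fun y => Real.log^[k + 1] (-Real.log y)) (d * -x⁻¹) x :=
    HasDerivAt.comp (h₂ := Real.log^[k + 1]) (h := fun y => -Real.log y) x h
      (Real.hasDerivAt_log hx.ne').neg
  have hder := hcomp.congr_of_eventuallyEq hev
  rw [hder.deriv, habs x ⟨hx, hx1⟩]
  calc -x * (d * -x⁻¹) = d := by field_simp
    _ ≤ _ := hd

end IteratedLog

/-! ### Construction of the spiky function. -/

section Construction

variable {n : ℕ}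

/-- Distances from the origin at which the spikes of the example are placed. -/
noncomputable def spikeDist (j : ℕ) : ℝ := (1 / 8) ^ (j + 1)

/-- Side length of the cube around a spike at distance `r` on which oscillation is measured. -/
noncomputable def spikeSide (r : ℝ) : ℝ := Real.exp (-Real.exp (1 / r))

/-- Radius of the spike at distance `r` from the origin. -/
noncomputable def spikeRadius (β r : ℝ) : ℝ := spikeSide r * r ^ β / 32

/-- Position of the `j`-th spike, on the axis `i₀`. -/
noncomputable def spikeCenter (i₀ : Fin n) (j : ℕ) : EuclideanSpace ℝ (Fin n) :=
  EuclideanSpace.single i₀ (spikeDist j)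

lemma spikeDist_pos (j : ℕ) : 0 < spikeDist j := by unfold spikeDist; positivity

lemma spikeDist_le (j : ℕ) : spikeDist j ≤ 1 / 8 := by
  unfold spikeDist
  exact pow_le_of_le_one (by norm_num) (by norm_num) (by omega)

lemma tendsto_spikeDist : Tendsto spikeDist atTop (𝓝[>] 0) := by
  refine tendsto_nhdsWithin_iff.2 ⟨?_, Eventually.of_forall spikeDist_pos⟩
  exact (tendsto_pow_atTop_nhds_zero_of_lt_one (by norm_num) (by norm_num)).comp
    (tendsto_add_atTop_nat 1)

/-- The ratio `1/8` of consecutive distances makes the annuli `r/2 < |x| < 2r` pairwise disjoint. -/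
lemma spikeDist_unique {i j : ℕ} {t : ℝ} (hi : spikeDist i / 2 < t) (hi' : t < 2 * spikeDist i)
    (hj : spikeDist j / 2 < t) (hj' : t < 2 * spikeDist j) : i = j := by
  have key : ∀ a b : ℕ, a < b → spikeDist b ≤ spikeDist a / 8 := by
    intro a b hab
    calc spikeDist b ≤ spikeDist (a + 1) :=
          pow_le_pow_of_le_one (by norm_num) (by norm_num) (by omega)
      _ = spikeDist a / 8 := by unfold spikeDist; ring
  have hpi := spikeDist_pos i
  have hpj := spikeDist_pos j
  rcases lt_trichotomy i j with h | h | h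
  · linarith [key i j h]
  · exact h
  · linarith [key j i h]

lemma spikeSide_pos (r : ℝ) : 0 < spikeSide r := Real.exp_pos _

lemma spikeSide_le_exp {r : ℝ} : spikeSide r ≤ Real.exp (-(1 / r)) :=
  Real.exp_le_exp.2 (by linarith [Real.add_one_le_exp (1 / r)])

lemma spikeSide_le {r : ℝ} (hr : 0 < r) : spikeSide r ≤ r / 2 := by
  have h1 : 2 * (1 / r) ≤ Real.exp (1 / r) := by
    have := Real.add_one_le_exp (1 / r - 1)
    have h2 : Real.exp (1 / r) = Real.exp (1 / r - 1) * Real.exp 1 := by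
      rw [← Real.exp_add]; ring_nf
    have h3 : (2 : ℝ) ≤ Real.exp 1 := by linarith [Real.add_one_le_exp 1]
    rw [h2]
    nlinarith [one_div_pos.2 hr]
  have h4 := Real.add_one_le_exp (Real.exp (1 / r))
  rw [spikeSide, Real.exp_neg]
  have h5 : 2 / r ≤ Real.exp (Real.exp (1 / r)) := by
    rw [mul_one_div] at h1
    linarith
  calc (Real.exp (Real.exp (1 / r)))⁻¹ ≤ (2 / r)⁻¹ := inv_anti₀ (by positivity) h5
    _ = r / 2 := inv_div _ _

lemma spikeRadius_pos (β : ℝ) {r : ℝ} (hr : 0 < r) : 0 < spikeRadius β r := by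
  have := spikeSide_pos r
  unfold spikeRadius
  positivity

lemma spikeRadius_le {β r : ℝ} (hβ : 0 < β) (hr : 0 < r) (hr1 : r ≤ 1) :
    spikeRadius β r ≤ spikeSide r / 32 := by
  have := Real.rpow_le_one hr.le hr1 hβ.le
  unfold spikeRadius
  nlinarith [spikeSide_pos r]

lemma norm_spikeCenter (i₀ : Fin n) (j : ℕ) : ‖spikeCenter i₀ j‖ = spikeDist j := by
  simp [spikeCenter, abs_of_pos (spikeDist_pos j)]

/-- A smooth bump supported near the `j`-th spike centre. -/
noncomputable def spike (β : ℝ) (i₀ : Fin n) (j : ℕ) : ContDiffBump (spikeCenter i₀ j) where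
  rIn := spikeRadius β (spikeDist j)
  rOut := 2 * spikeRadius β (spikeDist j)
  rIn_pos := spikeRadius_pos β (spikeDist_pos j)
  rIn_lt_rOut := by linarith [spikeRadius_pos β (spikeDist_pos j)]

/-- The sum of all bumps. -/
noncomputable def spikes (β : ℝ) (i₀ : Fin n) (x : EuclideanSpace ℝ (Fin n)) : ℝ :=
  ∑' j, spike β i₀ j x

/-- The example: `‖x‖^(-α)` with narrow spikes of height `‖x‖^(-β)`, cut off away from `0`. -/
noncomputable def spikyPower (α β : ℝ) (i₀ : Fin n) (χ : ContDiffBump (0 : EuclideanSpace ℝ (Fin n)))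
    (x : EuclideanSpace ℝ (Fin n)) : ℝ :=
  χ x * ‖x‖ ^ (-α) + χ x * (‖x‖ ^ (-β) * spikes β i₀ x)

variable {α β : ℝ} {i₀ : Fin n}

/-- The support radius `2σ` is at most `R/16 ≤ r/32`, so each bump stays inside its own annulus.
With the disjointness of the annuli, at most one bump is nonzero at any point. -/
lemma norm_bounds_of_mem_ball (hβ : 0 < β) {j : ℕ} {x : EuclideanSpace ℝ (Fin n)}
    (hx : ‖x - spikeCenter i₀ j‖ < 2 * spikeRadius β (spikeDist j)) :
    spikeDist j / 2 < ‖x‖ ∧ ‖x‖ < 2 * spikeDist j := by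
  have hr := spikeDist_pos j
  have h1 := spikeRadius_le hβ hr ((spikeDist_le j).trans (by norm_num))
  have h2 := spikeSide_le hr
  have h3 := abs_le.1 (abs_norm_sub_norm_le x (spikeCenter i₀ j))
  rw [norm_spikeCenter] at h3
  constructor <;> linarith [h3.1, h3.2]

lemma norm_sub_lt_of_spike_ne_zero {j : ℕ} {x : EuclideanSpace ℝ (Fin n)}
    (hx : spike β i₀ j x ≠ 0) : ‖x - spikeCenter i₀ j‖ < 2 * spikeRadius β (spikeDist j) := by
  have : x ∈ Function.support (spike β i₀ j) := hx
  rwa [ContDiffBump.support_eq, Metric.mem_ball, dist_eq_norm] at this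

lemma spikes_eq (hβ : 0 < β) {j : ℕ} {x : EuclideanSpace ℝ (Fin n)}
    (h1 : spikeDist j / 2 < ‖x‖) (h2 : ‖x‖ < 2 * spikeDist j) :
    spikes β i₀ x = spike β i₀ j x := by
  refine tsum_eq_single j fun i hij => ?_
  by_contra h
  obtain ⟨h3, h4⟩ := norm_bounds_of_mem_ball hβ (norm_sub_lt_of_spike_ne_zero h)
  exact hij (spikeDist_unique h3 h4 h1 h2)

lemma spikes_eq_zero_or (hβ : 0 < β) (x : EuclideanSpace ℝ (Fin n)) :
    spikes β i₀ x = 0 ∨ ∃ j, ‖x - spikeCenter i₀ j‖ < 2 * spikeRadius β (spikeDist j) ∧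
      spikes β i₀ x = spike β i₀ j x := by
  by_cases h : ∃ j, spike β i₀ j x ≠ 0
  · obtain ⟨j, hj⟩ := h
    have h1 := norm_sub_lt_of_spike_ne_zero hj
    obtain ⟨h2, h3⟩ := norm_bounds_of_mem_ball hβ h1
    exact Or.inr ⟨j, h1, spikes_eq hβ h2 h3⟩
  · push Not at h
    left
    simp [spikes, h]

lemma spikes_nonneg (x : EuclideanSpace ℝ (Fin n)) : 0 ≤ spikes β i₀ x :=
  tsum_nonneg fun j => (spike β i₀ j).nonneg' x

lemma spikes_le_one (hβ : 0 < β) (x : EuclideanSpace ℝ (Fin n)) : spikes β i₀ x ≤ 1 := by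
  rcases spikes_eq_zero_or (i₀ := i₀) hβ x with h | ⟨j, -, h⟩
  · rw [h]; exact zero_le_one
  · rw [h]; exact (spike β i₀ j).le_one

/-- The bumps accumulate only at the origin, so near any other point the series is a finite sum. -/
lemma contDiffAt_spikes (hβ : 0 < β) {x : EuclideanSpace ℝ (Fin n)} (hx : x ≠ 0) :
    ContDiffAt ℝ 1 (spikes β i₀) x := by
  have hx0 : 0 < ‖x‖ / 4 := by positivity
  obtain ⟨J, hJ⟩ := ((tendsto_nhdsWithin_iff.1 tendsto_spikeDist).1.eventually
    (gt_mem_nhds hx0)).exists_forall_of_atTop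
  have hev : spikes β i₀ =ᶠ[𝓝 x] fun y => ∑ j ∈ Finset.range J, spike β i₀ j y := by
    have : ∀ᶠ y in 𝓝 x, ‖x‖ / 2 < ‖y‖ :=
      continuous_norm.continuousAt.eventually (lt_mem_nhds (by linarith))
    filter_upwards [this] with y hy
    refine tsum_eq_sum fun j hj => ?_
    by_contra h
    have h1 := (norm_bounds_of_mem_ball hβ (norm_sub_lt_of_spike_ne_zero h)).2
    have h2 := hJ j (by simpa using hj)
    linarith
  refine ContDiffAt.congr_of_eventuallyEq ?_ hev
  exact ContDiffAt.sum fun j _ => (spike β i₀ j).contDiffAt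

lemma contDiffAt_norm_rpow {x : EuclideanSpace ℝ (Fin n)} (hx : x ≠ 0) (s : ℝ) :
    ContDiffAt ℝ 1 (fun y : EuclideanSpace ℝ (Fin n) => ‖y‖ ^ s) x :=
  (contDiffAt_norm ℝ hx).rpow_const_of_ne (norm_ne_zero_iff.2 hx)

lemma aestronglyMeasurable_of_continuousAt [NeZero n] {g : EuclideanSpace ℝ (Fin n) → ℝ}
    (hg : ∀ x, x ≠ 0 → ContinuousAt g x) : AEStronglyMeasurable g volume := by
  have h : AEStronglyMeasurable g (volume.restrict {(0 : EuclideanSpace ℝ (Fin n))}ᶜ) :=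
    ContinuousOn.aestronglyMeasurable (fun x hx => (hg x hx).continuousWithinAt)
      (measurableSet_singleton 0).compl
  rwa [Measure.restrict_eq_self_of_ae_mem (by
    simp [ae_iff])] at h

variable (χ : ContDiffBump (0 : EuclideanSpace ℝ (Fin n)))

lemma memLp_bump_mul_norm_rpow [NeZero n] {p : ℝ} (hp : 1 ≤ p) (hαp : α * p < n) :
    MemLp (fun x => χ x * ‖x‖ ^ (-α)) (ENNReal.ofReal p) volume := by
  have hp0 : 0 < p := by linarith
  have hmeas : AEStronglyMeasurable (fun x => χ x * ‖x‖ ^ (-α)) volume :=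
    aestronglyMeasurable_of_continuousAt fun x hx =>
      χ.continuous.continuousAt.mul (contDiffAt_norm_rpow hx _).continuousAt
  rw [← integrable_norm_rpow_iff hmeas (by simpa using hp0) ENNReal.ofReal_ne_top,
    ENNReal.toReal_ofReal hp0.le]
  have hn : 1 ≤ Module.finrank ℝ (EuclideanSpace ℝ (Fin n)) := by
    simpa using NeZero.one_le
  have hball : IntegrableOn (fun x : EuclideanSpace ℝ (Fin n) => ‖χ x * ‖x‖ ^ (-α)‖ ^ p)
      (Metric.ball 0 χ.rOut) volume := by
    refine integrableOn_ball_of_norm_le_rpow hn (α := α * p) (C := 1) (by simpa using hαp)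
      (Eventually.of_forall fun x => ?_) (hmeas.norm.aemeasurable.pow_const p).aestronglyMeasurable
    rw [one_mul, Real.norm_of_nonneg (by positivity), ← neg_mul, Real.rpow_mul (norm_nonneg _)]
    refine Real.rpow_le_rpow (norm_nonneg _) ?_ hp0.le
    rw [norm_mul, Real.norm_of_nonneg χ.nonneg, Real.norm_of_nonneg (by positivity)]
    exact mul_le_of_le_one_left (by positivity) χ.le_one
  refine (integrableOn_iff_integrable_of_support_subset fun x hx => ?_).1 hball
  rw [← χ.support_eq]
  intro h
  rw [Function.mem_support] at hx
  simp [h, Real.zero_rpow hp0.ne'] at hx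

/-- The exponential beats every power of `1/r`, so the terms are eventually at most `r` itself, and
the distances form a geometric sequence. -/
lemma summable_spike_weights (M : ℝ) :
    Summable fun j => (2 / spikeDist j) ^ M * Real.exp (-(1 / spikeDist j)) := by
  have hgeo : Summable spikeDist :=
    (summable_nat_add_iff 1).2 (summable_geometric_of_lt_one (by norm_num) (by norm_num))
  have ht : Tendsto (fun j => 1 / spikeDist j) atTop atTop := by
    simp only [one_div]
    exact tendsto_inv_nhdsGT_zero.comp tendsto_spikeDist
  have hlim := ((tendsto_rpow_mul_exp_neg_mul_atTop_nhds_zero (M + 1) 1 one_pos).comp ht).const_mul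
    ((2 : ℝ) ^ M)
  rw [mul_zero] at hlim
  have hev := hlim.eventually (gt_mem_nhds one_pos)
  refine hgeo.of_norm_bounded_eventually_nat ?_
  filter_upwards [hev] with j hj
  have hr := spikeDist_pos j
  rw [Real.norm_of_nonneg (by positivity)]
  simp only [Function.comp_apply, neg_mul, one_mul] at hj
  rw [Real.rpow_add (by positivity), Real.rpow_one] at hj
  rw [div_eq_mul_one_div, Real.mul_rpow (by norm_num) (by positivity)]
  set r := spikeDist j
  set E := Real.exp (-(1 / r))
  calc 2 ^ M * (1 / r) ^ M * E = (2 ^ M * ((1 / r) ^ M * (1 / r) * E)) * r := by field_simp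
    _ ≤ 1 * r := by gcongr
    _ = r := one_mul r

lemma volume_ball_spike_le [NeZero n] (hβ : 0 < β) (j : ℕ) :
    volume (Metric.ball (spikeCenter i₀ j) (2 * spikeRadius β (spikeDist j))) ≤
      ENNReal.ofReal (Real.exp (-(1 / spikeDist j))) := by
  have hr := spikeDist_pos j
  have hr8 := spikeDist_le j
  have h1 := spikeRadius_le hβ hr (hr8.trans (by norm_num))
  have h2 := spikeSide_le hr
  refine (measure_mono (ball_subset_cube _ _)).trans ?_
  rw [volume_cube]
  refine (pow_le_of_le_one zero_le ?_ (NeZero.ne n)).trans ?_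
  · rw [ENNReal.ofReal_le_one]
    linarith
  · refine ENNReal.ofReal_le_ofReal (le_trans ?_ spikeSide_le_exp)
    linarith [spikeSide_pos (spikeDist j)]

/-- No relation between `β`, `p` and `n` is needed: a spike has height a power of `1/r`, while the
volume of its support is at most `exp(-1/r)`. -/
lemma memLp_bump_mul_spikes [NeZero n] (hβ : 0 < β) {p : ℝ} (hp : 1 ≤ p) :
    MemLp (fun x => χ x * (‖x‖ ^ (-β) * spikes β i₀ x)) (ENNReal.ofReal p) volume := by
  have hp0 : 0 < p := by linarith
  refine ⟨aestronglyMeasurable_of_continuousAt fun x hx => χ.continuous.continuousAt.mul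
    ((contDiffAt_norm_rpow hx _).continuousAt.mul (contDiffAt_spikes hβ hx).continuousAt), ?_⟩
  rw [eLpNorm_lt_top_iff_lintegral_rpow_enorm_lt_top (by simpa using hp0) ENNReal.ofReal_ne_top,
    ENNReal.toReal_ofReal hp0.le]
  set B : ℕ → Set (EuclideanSpace ℝ (Fin n)) := fun j =>
    Metric.ball (spikeCenter i₀ j) (2 * spikeRadius β (spikeDist j))
  calc ∫⁻ x, ‖χ x * (‖x‖ ^ (-β) * spikes β i₀ x)‖ₑ ^ p
      ≤ ∫⁻ x, ∑' j, (B j).indicator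
          (fun _ => ENNReal.ofReal ((2 / spikeDist j) ^ (β * p))) x := by
        refine lintegral_mono fun x => ?_
        rcases spikes_eq_zero_or (i₀ := i₀) hβ x with h | ⟨j, hj, -⟩
        · simp [h, hp0]
        · refine le_trans ?_ (ENNReal.le_tsum j)
          have hxB : x ∈ B j := by simpa [B, dist_eq_norm] using hj
          have hr := spikeDist_pos j
          obtain ⟨h1, -⟩ := norm_bounds_of_mem_ball hβ hj
          rw [Set.indicator_of_mem hxB, Real.enorm_eq_ofReal_abs,
            ENNReal.ofReal_rpow_of_nonneg (abs_nonneg _) hp0.le, Real.rpow_mul (by positivity)]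
          refine ENNReal.ofReal_le_ofReal (Real.rpow_le_rpow (abs_nonneg _) ?_ hp0.le)
          have h0 : 0 ≤ spikes β i₀ x := spikes_nonneg x
          rw [abs_of_nonneg (mul_nonneg χ.nonneg (by positivity))]
          calc χ x * (‖x‖ ^ (-β) * spikes β i₀ x) ≤ 1 * (‖x‖ ^ (-β) * 1) := by
                gcongr
                · exact χ.le_one
                · exact spikes_le_one hβ x
            _ = ‖x‖ ^ (-β) := by ring
            _ ≤ (spikeDist j / 2) ^ (-β) :=
                Real.rpow_le_rpow_of_nonpos (by positivity) h1.le (by linarith)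
            _ = (2 / spikeDist j) ^ β := by
                rw [Real.rpow_neg (by positivity), ← Real.inv_rpow (by positivity), inv_div]
    _ = ∑' j, ENNReal.ofReal ((2 / spikeDist j) ^ (β * p)) * volume (B j) := by
        rw [lintegral_tsum fun j => (measurable_const.indicator measurableSet_ball).aemeasurable]
        simp_rw [B, lintegral_indicator_const measurableSet_ball]
    _ ≤ ∑' j, ENNReal.ofReal ((2 / spikeDist j) ^ (β * p) *
          Real.exp (-(1 / spikeDist j))) := by
        refine ENNReal.tsum_le_tsum fun j => ?_
        have hr := spikeDist_pos j
        rw [ENNReal.ofReal_mul (by positivity)]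
        gcongr
        exact volume_ball_spike_le hβ j
    _ < ⊤ := by
        have hpos : ∀ j, 0 ≤ (2 / spikeDist j) ^ (β * p) * Real.exp (-(1 / spikeDist j)) :=
          fun j => by have := spikeDist_pos j; positivity
        rw [← ENNReal.ofReal_tsum_of_nonneg hpos (summable_spike_weights _)]
        exact ENNReal.ofReal_lt_top

/-- There is a function between `‖x‖^(-α)` and `2‖x‖^(-β)` near the origin, in the same `L^p` as
`‖x‖^(-α)`, which is at least `‖x‖^(-β)` on a sequence of tiny balls and at most `‖x‖^(-α)` around
them. -/
theorem exists_spiky_power [NeZero n] (hα : 0 < α) (hαβ : α < β) (i₀ : Fin n) :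
    ∃ f : EuclideanSpace ℝ (Fin n) → ℝ, HasCompactSupport f ∧ ContDiffOn ℝ 1 f {0}ᶜ ∧
      (∀ p : ℝ, 1 ≤ p → α * p < n → MemLp f (ENNReal.ofReal p) volume) ∧
      (∀ x, 0 < ‖x‖ → ‖x‖ < 1 → ‖x‖ ^ (-α) ≤ f x ∧ f x ≤ 2 * ‖x‖ ^ (-β)) ∧
      ∀ j,
        (∀ x, ‖x - spikeCenter i₀ j‖ ≤ spikeRadius β (spikeDist j) → ‖x‖ ^ (-β) ≤ f x) ∧
        (∀ x, spikeDist j / 2 < ‖x‖ → ‖x‖ < 2 * spikeDist j →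
          2 * spikeRadius β (spikeDist j) ≤ ‖x - spikeCenter i₀ j‖ → f x ≤ ‖x‖ ^ (-α)) := by
  have hβ : 0 < β := hα.trans hαβ
  let χ : ContDiffBump (0 : EuclideanSpace ℝ (Fin n)) := ⟨1, 2, one_pos, one_lt_two⟩
  have hχ : ∀ x : EuclideanSpace ℝ (Fin n), ‖x‖ ≤ 1 → χ x = 1 := fun x hx =>
    χ.one_of_mem_closedBall (by simpa [χ] using hx)
  refine ⟨spikyPower α β i₀ χ, ?_, ?_, ?_, ?_, fun j => ⟨?_, ?_⟩⟩
  · exact χ.hasCompactSupport.mul_right.add χ.hasCompactSupport.mul_right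
  · intro x hx
    exact ((χ.contDiffAt.mul (contDiffAt_norm_rpow hx _)).add (χ.contDiffAt.mul
      ((contDiffAt_norm_rpow hx _).mul (contDiffAt_spikes hβ hx)))).contDiffWithinAt
  · exact fun p hp hαp => (memLp_bump_mul_norm_rpow χ hp hαp).add (memLp_bump_mul_spikes χ hβ hp)
  · intro x hx0 hx1
    have h0 : 0 ≤ spikes β i₀ x := spikes_nonneg x
    have h1 : spikes β i₀ x ≤ 1 := spikes_le_one hβ x
    have h2 : ‖x‖ ^ (-α) ≤ ‖x‖ ^ (-β) :=
      Real.rpow_le_rpow_of_exponent_ge hx0 hx1.le (by linarith)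
    have h3 : 0 ≤ ‖x‖ ^ (-β) := by positivity
    simp only [spikyPower, hχ x hx1.le, one_mul]
    constructor
    · linarith [mul_nonneg h3 h0]
    · linarith [mul_le_of_le_one_right h3 h1]
  · intro x hx
    have hr := spikeDist_pos j
    obtain ⟨h1, h2⟩ := norm_bounds_of_mem_ball hβ (j := j)
      (hx.trans_lt (by linarith [spikeRadius_pos β hr]))
    have hx1 : ‖x‖ ≤ 1 := by linarith [spikeDist_le j]
    have h3 : spike β i₀ j x = 1 := (spike β i₀ j).one_of_mem_closedBall (by
      rw [Metric.mem_closedBall, dist_eq_norm]; exact hx)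
    simp only [spikyPower, hχ x hx1, one_mul, spikes_eq hβ h1 h2, h3, mul_one]
    linarith [Real.rpow_nonneg (norm_nonneg x) (-α)]
  · intro x h1 h2 hx
    have hx1 : ‖x‖ ≤ 1 := by linarith [spikeDist_le j]
    have h3 : spike β i₀ j x = 0 := (spike β i₀ j).zero_of_le_dist (by
      rw [dist_eq_norm]; exact hx)
    simp only [spikyPower, hχ x hx1, one_mul, spikes_eq hβ h1 h2, h3, mul_zero, add_zero, le_refl]

end Construction

/-! ### Upper and lower bounds for `M_δ f` near the origin and near a spike. -/

section Estimates

variable {n : ℕ} {α β δ : ℝ} {f : EuclideanSpace ℝ (Fin n) → ℝ} {i₀ : Fin n}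

/-- Splits the average into a background of size `A` and an exceptional set `S`, which will be a
spike or empty. The exponent `1` is kept explicit to match the form required by
`maximalPow_rpow_le`. -/
lemma setLAverage_rpow_one_le {c : EuclideanSpace ℝ (Fin n)} {r A B : ℝ} (hr : 0 < r)
    {S : Set (EuclideanSpace ℝ (Fin n))} (hS : MeasurableSet S)
    (h : ∀ y ∈ cube c r, |f y| ≤ A ∨ y ∈ S ∧ |f y| ≤ B) :
    (⨍⁻ y in cube c r, ‖f y‖ₑ ^ (1 : ℝ) ∂volume) ^ (1 / (1 : ℝ)) ≤
      ENNReal.ofReal A + ENNReal.ofReal B * volume S / ENNReal.ofReal r ^ n := by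
  simp only [ENNReal.rpow_one, div_one]
  rw [setLAverage_eq, volume_cube]
  have h1 : ∫⁻ y in cube c r, ‖f y‖ₑ ≤
      ENNReal.ofReal A * ENNReal.ofReal r ^ n + ENNReal.ofReal B * volume S := by
    calc ∫⁻ y in cube c r, ‖f y‖ₑ
        ≤ ∫⁻ y in cube c r, (ENNReal.ofReal A + S.indicator (fun _ => ENNReal.ofReal B) y) := by
          refine setLIntegral_mono' (measurableSet_cube c r) fun y hy => ?_
          rw [Real.enorm_eq_ofReal_abs]
          rcases h y hy with h | ⟨hyS, h⟩
          · exact (ENNReal.ofReal_le_ofReal h).trans le_self_add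
          · rw [Set.indicator_of_mem hyS]
            exact (ENNReal.ofReal_le_ofReal h).trans le_add_self
      _ ≤ _ := by
          rw [lintegral_add_left measurable_const, setLIntegral_const, volume_cube,
            lintegral_indicator_const hS]
          gcongr
          exact Measure.restrict_le_self
  have hr0 : ENNReal.ofReal r ^ n ≠ 0 := pow_ne_zero _ (by simpa using hr)
  have hr1 : ENNReal.ofReal r ^ n ≠ ⊤ := by finiteness
  calc (∫⁻ y in cube c r, ‖f y‖ₑ) / ENNReal.ofReal r ^ n
      ≤ (ENNReal.ofReal A * ENNReal.ofReal r ^ n + ENNReal.ofReal B * volume S) /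
          ENNReal.ofReal r ^ n := by gcongr
    _ = _ := by rw [ENNReal.add_div, ENNReal.mul_div_cancel_right hr0 hr1]

lemma le_maximalPow_rpow_of_norm [NeZero n] (hα : 0 < α) (hδ : 0 < δ)
    (hf : ∀ x, 0 < ‖x‖ → ‖x‖ < 1 → ‖x‖ ^ (-α) ≤ f x)
    {x : EuclideanSpace ℝ (Fin n)} (hx0 : 0 < ‖x‖) (hx1 : ‖x‖ < 1 / 2) :
    ENNReal.ofReal ((2 * ‖x‖) ^ (-α)) ≤ maximalPow δ f x ^ (1 / δ) := by
  have hn : (0 : ℝ) < n := by exact_mod_cast NeZero.pos n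
  -- A cube of this side centred at `x` lies within distance `‖x‖ / 2` of `x`, so it avoids the
  -- origin and stays in the unit ball.
  have hr : 0 < ‖x‖ / n := by positivity
  refine ofReal_le_maximalPow_rpow hδ hr (mem_cube_self x hr.le) fun y hy => ?_
  have h1 := norm_sub_le_of_mem_cube hr.le hy
  have h2 : (n : ℝ) * (‖x‖ / n / 2) = ‖x‖ / 2 := by field_simp
  rw [h2] at h1
  have h3 := abs_le.1 (abs_norm_sub_norm_le y x)
  have hy0 : 0 < ‖y‖ := by linarith [h3.1]
  refine le_trans ?_ (hf y hy0 (by linarith [h3.2]))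
  exact Real.rpow_le_rpow_of_nonpos hy0 (by linarith [h3.2]) (by linarith)

/-- A crude bound, serving only for finiteness and for integrability after logarithms. Small cubes
through `x` stay away from the origin and see the pointwise bound; the others are controlled by the
`L¹` norm. -/
lemma exists_maximalPow_rpow_le [NeZero n] (hβ : 0 < β) (hf1 : MemLp f 1 volume)
    (hf : ∀ x, 0 < ‖x‖ → ‖x‖ < 1 → |f x| ≤ 2 * ‖x‖ ^ (-β)) :
    ∃ C > 0, ∀ δ, 0 < δ → δ ≤ 1 → ∀ x, 0 < ‖x‖ → ‖x‖ < 1 / 2 →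
      maximalPow δ f x ^ (1 / δ) ≤ ENNReal.ofReal (C * ‖x‖ ^ (-(β + n))) := by
  have hn : (0 : ℝ) < n := by exact_mod_cast NeZero.pos n
  set I := (eLpNorm f 1 volume).toReal with hI
  have hI0 : 0 ≤ I := ENNReal.toReal_nonneg
  refine ⟨2 * 2 ^ β + I * (2 * n) ^ (n : ℝ), by positivity, fun δ hδ hδ1 x hx0 hx1 => ?_⟩
  refine maximalPow_rpow_le hδ hf1.1 fun c r hr hx => ⟨1, hδ1, ?_⟩
  rcases le_total r (‖x‖ / (2 * n)) with hrx | hrx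
  · refine (setLAverage_rpow_one_le (A := 2 * 2 ^ β * ‖x‖ ^ (-β)) (B := 0) hr
      MeasurableSet.empty fun y hy => Or.inl ?_).trans ?_
    · have h1 := norm_sub_le_of_mem_cube_of_mem_cube hr.le hy hx
      have h2 : (n : ℝ) * r ≤ ‖x‖ / 2 := by
        calc (n : ℝ) * r ≤ n * (‖x‖ / (2 * n)) := by gcongr
          _ = ‖x‖ / 2 := by field_simp
      have h3 := abs_le.1 (abs_norm_sub_norm_le y x)
      have hy0 : 0 < ‖y‖ := by linarith [h3.1]
      refine (hf y hy0 (by linarith [h3.2])).trans ?_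
      rw [mul_assoc]
      gcongr
      calc ‖y‖ ^ (-β) ≤ (‖x‖ / 2) ^ (-β) :=
            Real.rpow_le_rpow_of_nonpos (by positivity) (by linarith [h3.1]) (by linarith)
        _ = 2 ^ β * ‖x‖ ^ (-β) := by
            rw [Real.div_rpow hx0.le zero_le_two, Real.rpow_neg zero_le_two]
            field_simp
    · simp only [measure_empty, mul_zero, ENNReal.zero_div, add_zero]
      refine ENNReal.ofReal_le_ofReal ?_
      gcongr ?_ * ?_
      · linarith [show 0 ≤ I * (2 * n) ^ (n : ℝ) by positivity]
      · exact Real.rpow_le_rpow_of_exponent_ge hx0 (by linarith) (by linarith)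
  · refine (setLAverage_rpow_le_eLpNorm one_pos c (by positivity) hrx).trans ?_
    rw [ENNReal.ofReal_one, ← ENNReal.ofReal_toReal hf1.2.ne, ← hI, ← ENNReal.ofReal_mul hI0,
      div_one]
    refine ENNReal.ofReal_le_ofReal ?_
    have h1 : (‖x‖ / (2 * n)) ^ (-(n : ℝ)) = (2 * n) ^ (n : ℝ) * ‖x‖ ^ (-(n : ℝ)) := by
      rw [Real.div_rpow hx0.le (by positivity), Real.rpow_neg (x := 2 * (n : ℝ)) (by positivity)]
      field_simp
    rw [h1, ← mul_assoc]
    gcongr ?_ * ?_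
    · linarith [show (0 : ℝ) ≤ 2 * 2 ^ β by positivity]
    · exact Real.rpow_le_rpow_of_exponent_ge hx0 (by linarith) (by linarith)

/-- Away from a spike, at a distance comparable to `spikeSide`, the maximal function does not see
the spike. -/
lemma exists_maximalPow_rpow_le_of_dist_spike [NeZero n] (hα : 0 < α) (hαβ : α < β)
    {p : ℝ} (hp : 1 ≤ p) (hαp : α * p < n)
    (hfp : MemLp f (ENNReal.ofReal p) volume)
    (hf : ∀ x, 0 < ‖x‖ → ‖x‖ < 1 → |f x| ≤ 2 * ‖x‖ ^ (-β))
    (hs : ∀ j x, spikeDist j / 2 < ‖x‖ → ‖x‖ < 2 * spikeDist j →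
      2 * spikeRadius β (spikeDist j) ≤ ‖x - spikeCenter i₀ j‖ → |f x| ≤ ‖x‖ ^ (-α)) :
    ∃ C > 0, ∀ δ, 0 < δ → δ ≤ 1 → ∀ j x, 3 / 4 * spikeDist j ≤ ‖x‖ → ‖x‖ ≤ 5 / 4 * spikeDist j →
      3 / 16 * spikeSide (spikeDist j) ≤ |x i₀ - spikeCenter i₀ j i₀| →
      maximalPow δ f x ^ (1 / δ) ≤ ENNReal.ofReal (C * spikeDist j ^ (-(n / p))) := by
  have hβ : 0 < β := hα.trans hαβ
  have hp0 : 0 < p := by linarith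
  have hn : (0 : ℝ) < n := by exact_mod_cast NeZero.pos n
  have hγ : α < n / p := (lt_div_iff₀ hp0).2 hαp
  set γ : ℝ := n / p
  set I := (eLpNorm f (ENNReal.ofReal p) volume).toReal with hI
  have hI0 : 0 ≤ I := ENNReal.toReal_nonneg
  refine ⟨2 ^ α + 2 * 2 ^ β + I * (8 * n) ^ γ, by positivity, fun δ hδ hδ1 j x hx1 hx2 hxi => ?_⟩
  have hr0 := spikeDist_pos j
  have hr8 := spikeDist_le j
  have hσR := spikeRadius_le hβ hr0 (hr8.trans (by norm_num))
  have hσ0 := spikeRadius_pos β hr0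
  have hσ_eq : spikeRadius β (spikeDist j) =
      spikeSide (spikeDist j) * spikeDist j ^ β / 32 := rfl
  have hR0 := spikeSide_pos (spikeDist j)
  have hs := hs j
  set r := spikeDist j
  set σ := spikeRadius β r
  set R := spikeSide r
  have hrγ : 1 ≤ r ^ (-γ) :=
    Real.one_le_rpow_of_pos_of_le_one_of_nonpos hr0 (by linarith) (by linarith)
  have hrα : (r / 2) ^ (-α) ≤ 2 ^ α * r ^ (-γ) := by
    rw [Real.div_rpow hr0.le zero_le_two, Real.rpow_neg zero_le_two, div_inv_eq_mul, mul_comm]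
    gcongr ?_ * ?_
    exact Real.rpow_le_rpow_of_exponent_ge hr0 (by linarith) (by linarith)
  refine maximalPow_rpow_le hδ hfp.1 fun c l hl hx => ?_
  -- A cube of side at most `r / (8n)` through `x` has diameter at most `r / 8`, so it stays in the
  -- annulus `r/2 < |y| < 2r`, where only the `j`-th spike is present.
  rcases le_total l (r / (8 * n)) with hlr | hlr
  · refine ⟨1, hδ1, ?_⟩
    have hnear : ∀ y ∈ cube c l, r / 2 < ‖y‖ ∧ ‖y‖ < 2 * r := by
      intro y hy
      have h1 := norm_sub_le_of_mem_cube_of_mem_cube hl.le hy hx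
      have h2 : (n : ℝ) * l ≤ r / 8 := by
        calc (n : ℝ) * l ≤ n * (r / (8 * n)) := by gcongr
          _ = r / 8 := by field_simp
      have h3 := abs_le.1 (abs_norm_sub_norm_le y x)
      constructor <;> linarith [h3.1, h3.2]
    have hbase : ∀ y ∈ cube c l, 2 * σ ≤ ‖y - spikeCenter i₀ j‖ → |f y| ≤ (r / 2) ^ (-α) := by
      intro y hy hyσ
      obtain ⟨h1, h2⟩ := hnear y hy
      exact (hs y h1 h2 hyσ).trans
        (Real.rpow_le_rpow_of_nonpos (by positivity) h1.le (by linarith))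
    by_cases hmeet : ∃ z ∈ cube c l, ‖z - spikeCenter i₀ j‖ < 2 * σ
    · obtain ⟨z, hz, hzσ⟩ := hmeet
      -- The `i₀`-coordinates of `x` and `z` differ by at least `3R/16 - 2σ`, and `2σ ≤ R/16`.
      have hlR : R / 8 ≤ l := by
        have h1 := abs_sub_le_of_mem_cube hx hz i₀
        have h2 := abs_apply_le_norm (z - spikeCenter i₀ j) i₀
        rw [PiLp.sub_apply] at h2
        have h3 := abs_sub_le (x i₀) (z i₀) (spikeCenter i₀ j i₀)
        linarith
      refine (setLAverage_rpow_one_le (A := (r / 2) ^ (-α)) (B := 2 * (2 ^ β * r ^ (-β))) hl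
        (S := Metric.ball (spikeCenter i₀ j) (2 * σ)) measurableSet_ball fun y hy => ?_).trans ?_
      · rcases le_or_gt (2 * σ) ‖y - spikeCenter i₀ j‖ with h | h
        · exact Or.inl (hbase y hy h)
        · refine Or.inr ⟨by simpa [dist_eq_norm] using h, ?_⟩
          obtain ⟨h1, h2⟩ := hnear y hy
          refine (hf y (by linarith) (by linarith)).trans ?_
          gcongr
          calc ‖y‖ ^ (-β) ≤ (r / 2) ^ (-β) :=
                Real.rpow_le_rpow_of_nonpos (by positivity) h1.le (by linarith)
            _ = 2 ^ β * r ^ (-β) := by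
                rw [Real.div_rpow hr0.le zero_le_two, Real.rpow_neg zero_le_two]
                field_simp
      · have hvol : volume (Metric.ball (spikeCenter i₀ j) (2 * σ)) / ENNReal.ofReal l ^ n ≤
            ENNReal.ofReal (r ^ β) := by
          have h1 : volume (Metric.ball (spikeCenter i₀ j) (2 * σ)) ≤
              ENNReal.ofReal (4 * σ) ^ n := by
            refine (measure_mono (ball_subset_cube _ _)).trans_eq ?_
            rw [volume_cube]
            ring_nf
          -- Here the factor `r ^ β` in the spike radius pays off: the fraction of the cube met by
          -- the spike is at most `r ^ β`, which cancels the height `r ^ (-β)`. With `l ≥ R/8`, the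
          -- constant `32` is exactly what is needed.
          have hq : 4 * σ / l ≤ r ^ β := by
            rw [div_le_iff₀ hl, hσ_eq]
            have : 0 ≤ r ^ β := by positivity
            nlinarith
          have hq1 : r ^ β ≤ 1 := Real.rpow_le_one hr0.le (by linarith) hβ.le
          calc volume (Metric.ball (spikeCenter i₀ j) (2 * σ)) / ENNReal.ofReal l ^ n
              ≤ ENNReal.ofReal (4 * σ) ^ n / ENNReal.ofReal l ^ n := by gcongr
            _ = ENNReal.ofReal ((4 * σ / l) ^ n) := by
                rw [div_pow, ENNReal.ofReal_div_of_pos (by positivity),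
                  ENNReal.ofReal_pow (by positivity), ENNReal.ofReal_pow hl.le]
            _ ≤ _ := by
                refine ENNReal.ofReal_le_ofReal ?_
                refine (pow_le_of_le_one (by positivity) (hq.trans hq1) (NeZero.ne n)).trans hq
        rw [mul_div_assoc]
        calc ENNReal.ofReal ((r / 2) ^ (-α)) + ENNReal.ofReal (2 * (2 ^ β * r ^ (-β))) *
              (volume (Metric.ball (spikeCenter i₀ j) (2 * σ)) / ENNReal.ofReal l ^ n)
            ≤ ENNReal.ofReal ((r / 2) ^ (-α)) + ENNReal.ofReal (2 * (2 ^ β * r ^ (-β))) *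
              ENNReal.ofReal (r ^ β) := by gcongr
          _ = ENNReal.ofReal ((r / 2) ^ (-α) + 2 * 2 ^ β) := by
              rw [← ENNReal.ofReal_mul (by positivity), ← ENNReal.ofReal_add (by positivity)
                (by positivity), Real.rpow_neg hr0.le]
              congr 2
              field_simp
          _ ≤ _ := by
              refine ENNReal.ofReal_le_ofReal ?_
              have h1 : (0 : ℝ) ≤ I * (8 * n) ^ γ * r ^ (-γ) := by positivity
              have h2 : (0 : ℝ) ≤ 2 * 2 ^ β * (r ^ (-γ) - 1) :=
                mul_nonneg (by positivity) (by linarith)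
              linarith
    · push Not at hmeet
      refine (setLAverage_rpow_one_le (A := (r / 2) ^ (-α)) (B := 0) hl
        MeasurableSet.empty fun y hy => Or.inl (hbase y hy (hmeet y hy))).trans ?_
      simp only [measure_empty, mul_zero, ENNReal.zero_div, add_zero]
      refine ENNReal.ofReal_le_ofReal (hrα.trans ?_)
      gcongr
      linarith [show 0 ≤ 2 * 2 ^ β + I * (8 * n) ^ γ by positivity]
  -- Large cubes may contain the origin or other spikes, so no pointwise bound is available; the
  -- exponent `p` gives `l ^ (-n/p)`, hence `r ^ (-γ)` up to a constant.
  · refine ⟨p, hδ1.trans hp, (setLAverage_rpow_le_eLpNorm hp0 c (by positivity) hlr).trans ?_⟩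
    rw [← ENNReal.ofReal_toReal hfp.2.ne, ← hI, ← ENNReal.ofReal_mul hI0]
    refine ENNReal.ofReal_le_ofReal ?_
    change I * (r / (8 * n)) ^ (-γ) ≤ _
    have h1 : (r / (8 * n)) ^ (-γ) = (8 * n) ^ γ * r ^ (-γ) := by
      rw [Real.div_rpow hr0.le (by positivity), Real.rpow_neg (x := 8 * (n : ℝ)) (by positivity)]
      field_simp
    rw [h1, ← mul_assoc]
    gcongr
    linarith [show (0 : ℝ) ≤ 2 ^ α + 2 * 2 ^ β by positivity]

end Estimates

/-! ### Local integrability and blow-up of the oscillation. -/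

section Oscillation

variable {n : ℕ} {α β δ : ℝ} {f : EuclideanSpace ℝ (Fin n) → ℝ} {i₀ : Fin n}

/-- Since `φStar` is prescribed only near infinity, it can be evaluated or compared at `M_δ f` only
where `M_δ f` is large; the lower bound `|x|^(-α)` guarantees this near the origin. -/
lemma eventually_of_eventuallyEq_iterLog {k : ℕ} {φStar : ℝ → ℝ}
    (h : φStar =ᶠ[atTop] iterLog k) :
    ∀ᶠ y : ℝ in atTop, φStar y = Real.log^[k] (Real.log y) ∧ 1 ≤ Real.log^[k] (Real.log y) ∧
      Real.log^[k] (Real.log y) ≤ Real.log y ∧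
      ∀ z, y ≤ z → Real.log^[k] (Real.log y) ≤ Real.log^[k] (Real.log z) := by
  filter_upwards [h, Real.tendsto_log_atTop.eventually (eventually_one_le_iterate_log_le k),
    Real.tendsto_log_atTop.eventually (eventually_iterate_log_mono k),
    eventually_ge_atTop 1] with y h1 h2 h3 hy
  refine ⟨?_, h2.1, h2.2, fun z hz => h3 _ (Real.log_le_log (by linarith) hz)⟩
  rw [h1, iterLog, abs_of_nonneg (Real.log_nonneg hy)]

lemma tendsto_const_mul_rpow_neg (hα : 0 < α) (a : ℝ) (ha : 0 < a) :
    Tendsto (fun r : ℝ => (a * r) ^ (-α)) (𝓝[>] 0) atTop := by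
  have h : Tendsto (fun r : ℝ => a ^ (-α) * r ^ (-α)) (𝓝[>] 0) atTop :=
    (tendsto_rpow_neg_nhdsGT_zero (neg_neg_of_pos hα)).const_mul_atTop (by positivity)
  refine h.congr' ?_
  filter_upwards [self_mem_nhdsWithin] with r hr
  rw [Real.mul_rpow ha.le (le_of_lt hr)]

/-- A logarithm is dominated by an arbitrarily small power. Exponent `1 / (2N)` turns the bound
`|x|^(-N)` into `|x|^(-1/2)`, which is locally integrable in every dimension `n ≥ 1`. -/
lemma integrableOn_comp_maximal [NeZero n] {m C N : ℝ} (hN : 0 < N) (hC : 0 < C)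
    {k : ℕ} {φStar : ℝ → ℝ} (h : φStar =ᶠ[atTop] iterLog k) (hα : 0 < α)
    (hlow : ∀ x, 0 < ‖x‖ → ‖x‖ < m → (2 * ‖x‖) ^ (-α) ≤ maximal δ f x) (hm : 0 < m)
    (hup : ∀ x, 0 < ‖x‖ → ‖x‖ < m → maximal δ f x ≤ C * ‖x‖ ^ (-N)) :
    ∃ ρ > 0, IntegrableOn (fun x => φStar (maximal δ f x)) (Metric.ball 0 ρ) volume := by
  have hev := (tendsto_const_mul_rpow_neg hα 2 two_pos).eventually
    (eventually_forall_ge_atTop.2 ((eventually_of_eventuallyEq_iterLog h).and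
      (eventually_ge_atTop 1)))
  obtain ⟨ρ, hρ, hρ'⟩ := mem_nhdsGT_iff_exists_Ioo_subset.1 hev
  replace hρ : 0 < ρ := hρ
  refine ⟨min ρ m, lt_min hρ hm, ?_⟩
  have hgood : ∀ x : EuclideanSpace ℝ (Fin n), x ≠ 0 → x ∈ Metric.ball 0 (min ρ m) →
      φStar (maximal δ f x) = iterLog k (maximal δ f x) ∧
      ‖iterLog k (maximal δ f x)‖ ≤
        (C ^ (1 / (2 * N)) / (1 / (2 * N))) * ‖x‖ ^ (-(1 / 2 : ℝ)) := by
    intro x hx0 hx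
    rw [mem_ball_zero_iff, lt_min_iff] at hx
    have hpos := norm_pos_iff.2 hx0
    obtain ⟨⟨h1, h2, h3, -⟩, h4⟩ := hρ' ⟨hpos, hx.1⟩ _ (hlow x hpos hx.2)
    have h5 : iterLog k (maximal δ f x) = Real.log^[k] (Real.log (maximal δ f x)) := by
      rw [iterLog, abs_of_nonneg (Real.log_nonneg h4)]
    refine ⟨h1.trans h5.symm, ?_⟩
    rw [h5, Real.norm_of_nonneg (by linarith)]
    calc Real.log^[k] (Real.log (maximal δ f x)) ≤ Real.log (maximal δ f x) := h3
      _ ≤ maximal δ f x ^ (1 / (2 * N)) / (1 / (2 * N)) :=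
          Real.log_le_rpow_div (by linarith) (by positivity)
      _ ≤ (C * ‖x‖ ^ (-N)) ^ (1 / (2 * N)) / (1 / (2 * N)) := by
          gcongr
          exact hup x hpos hx.2
      _ = _ := by
          rw [Real.mul_rpow hC.le (by positivity), ← Real.rpow_mul hpos.le,
            show -N * (1 / (2 * N)) = -(1 / 2) by field_simp]
          ring
  have hae : ∀ᵐ x ∂volume.restrict (Metric.ball (0 : EuclideanSpace ℝ (Fin n)) (min ρ m)),
      x ≠ 0 ∧ x ∈ Metric.ball (0 : EuclideanSpace ℝ (Fin n)) (min ρ m) := by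
    refine Filter.Eventually.and (ae_restrict_of_ae ?_) (ae_restrict_mem measurableSet_ball)
    simp [ae_iff]
  have hint : IntegrableOn (fun x => iterLog k (maximal δ f x)) (Metric.ball 0 (min ρ m))
      volume := by
    have hn1 : 1 ≤ n := NeZero.one_le
    have hn2 : (1 : ℝ) ≤ n := by exact_mod_cast hn1
    refine integrableOn_ball_of_norm_le_rpow (α := 1 / 2)
      (C := C ^ (1 / (2 * N)) / (1 / (2 * N))) (by simpa using hn1)
      (by rw [finrank_euclideanSpace_fin]; linarith) ?_ ?_
    · filter_upwards [hae] with x hx using (hgood x hx.1 hx.2).2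
    · have hmeas : Measurable (iterLog k) :=
        (measurable_iterate_log k).comp (Real.measurable_log.abs)
      exact (hmeas.comp (measurable_maximal δ f)).aestronglyMeasurable
  refine hint.congr ?_
  filter_upwards [hae] with x hx using (hgood x hx.1 hx.2).1.symm

lemma tendsto_spikeSide : Tendsto spikeSide (𝓝[>] 0) (𝓝[>] 0) := by
  refine tendsto_nhdsWithin_iff.2 ⟨?_, Eventually.of_forall spikeSide_pos⟩
  have h : Tendsto (fun r : ℝ => r / 2) (𝓝[>] 0) (𝓝 0) := by
    have : Tendsto (fun r : ℝ => r / 2) (𝓝 0) (𝓝 (0 / 2)) := tendsto_id.div_const 2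
    rw [zero_div] at this
    exact this.mono_left nhdsWithin_le_nhds
  refine tendsto_of_tendsto_of_tendsto_of_le_of_le' tendsto_const_nhds h
    (Eventually.of_forall fun r => (spikeSide_pos r).le) ?_
  filter_upwards [self_mem_nhdsWithin] with r hr using spikeSide_le hr

lemma tendsto_rpow_mul_exp_one_div (a M : ℝ) (ha : 0 < a) :
    Tendsto (fun r : ℝ => a * r ^ M * Real.exp (1 / r)) (𝓝[>] 0) atTop := by
  have h := ((tendsto_exp_div_rpow_atTop M).comp tendsto_inv_nhdsGT_zero).const_mul_atTop ha
  refine h.congr' ?_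
  filter_upwards [self_mem_nhdsWithin] with r hr
  replace hr : 0 < r := hr
  simp only [Function.comp_apply]
  rw [Real.inv_rpow hr.le, one_div, div_inv_eq_mul]
  ring

/-- The gap between the iterated logarithms of `r^(-β)` and `r^(-γ)` is at least a power of `r`. -/
lemma eventually_rpow_le_iterate_log_sub {γ C : ℝ} (hγ : 0 < γ) (hγβ : γ < β) (hC : 0 < C)
    (k : ℕ) : ∀ᶠ r : ℝ in 𝓝[>] 0, r ^ (β * k) ≤
      Real.log^[k] (Real.log ((2 * r) ^ (-β))) - Real.log^[k] (Real.log (C * r ^ (-γ))) := by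
  have hv : Tendsto (fun r : ℝ => C * r ^ (-γ)) (𝓝[>] 0) atTop :=
    (tendsto_rpow_neg_nhdsGT_zero (neg_neg_of_pos hγ)).const_mul_atTop hC
  have hlog : Tendsto (fun r => (β - γ) * -Real.log r) (𝓝[>] 0) atTop :=
    (tendsto_neg_atBot_atTop.comp Real.tendsto_log_nhdsGT_zero).const_mul_atTop (by linarith)
  filter_upwards [(Real.tendsto_log_atTop.comp hv).eventually (eventually_le_iterate_log_sub k),
    (Real.tendsto_log_atTop.comp hv).eventually_ge_atTop 1,
    hlog.eventually_ge_atTop (1 + β * Real.log 2 + Real.log C), self_mem_nhdsWithin]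
    with r h1 h2 h3 hr
  replace hr : 0 < r := hr
  simp only [Function.comp_apply] at h1 h2
  have hu : Real.log ((2 * r) ^ (-β)) = -β * Real.log 2 - β * Real.log r := by
    rw [Real.log_rpow (by positivity), Real.log_mul (by norm_num) hr.ne']
    ring
  have hv' : Real.log (C * r ^ (-γ)) = Real.log C - γ * Real.log r := by
    rw [Real.log_mul hC.ne' (by positivity), Real.log_rpow hr]
    ring
  set u := Real.log ((2 * r) ^ (-β)) with hu_def
  set v := Real.log (C * r ^ (-γ))
  have huv : 1 ≤ u - v := by rw [hu, hv']; linarith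
  refine le_trans ?_ (h1 u (by linarith))
  have hu0 : 0 < u := by linarith
  have hur : u ≤ r ^ (-β) := by
    refine (Real.log_le_self (by positivity)).trans ?_
    exact Real.rpow_le_rpow_of_nonpos hr (by linarith) (by linarith)
  calc r ^ (β * k) = 1 / (r ^ (-β)) ^ k := by
        rw [← Real.rpow_natCast, ← Real.rpow_mul hr.le, one_div, ← Real.rpow_neg hr.le]
        ring_nf
    _ ≤ (u - v) / u ^ k := by gcongr

/-- Inside the cube of side `R` about a spike, compare two subcubes of side `σ / n`: one on the
spike and one displaced by `R / 4`. As `r → 0` the resulting lower bound exceeds any prescribed `K`.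
-/
lemma oscSup_eq_top [NeZero n] {γ C : ℝ} (hα : 0 < α) (hγ : 0 < γ) (hγβ : γ < β)
    (hC : 0 < C) {k : ℕ} (hk : 1 ≤ k) {φStar φ : ℝ → ℝ} (h : φStar =ᶠ[atTop] iterLog k)
    (hφ : φ =ᶠ[𝓝[>] 0] fun x => -x * deriv (iterLog k) x)
    (hlow : ∀ x, 0 < ‖x‖ → ‖x‖ < 1 / 2 → (2 * ‖x‖) ^ (-α) ≤ maximal δ f x)
    (hspike : ∀ j, ∀ x ∈ cube (spikeCenter i₀ j) (spikeRadius β (spikeDist j) / n),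
      (2 * spikeDist j) ^ (-β) ≤ maximal δ f x)
    (hup : ∀ j x, 3 / 4 * spikeDist j ≤ ‖x‖ → ‖x‖ ≤ 5 / 4 * spikeDist j →
      3 / 16 * spikeSide (spikeDist j) ≤ |x i₀ - spikeCenter i₀ j i₀| →
      maximal δ f x ≤ C * spikeDist j ^ (-γ))
    {ρ η : ℝ} (hρ : 0 < ρ) (hη : 0 < η) :
    oscSup φ η (Metric.ball 0 ρ) (fun x => φStar (maximal δ f x)) = ⊤ := by
  have hβ : 0 < β := hγ.trans hγβ
  have hn : (1 : ℝ) ≤ n := by exact_mod_cast (NeZero.one_le : 1 ≤ n)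
  refine ENNReal.eq_top_of_forall_nnreal_le fun K => ?_
  have hφ' : ∀ᶠ x in 𝓝[>] 0, φ x ≤ |Real.log x|⁻¹ := by
    filter_upwards [hφ, eventually_neg_mul_deriv_iterLog_le hk] with x h1 h2
    rwa [h1]
  have hstar := eventually_forall_ge_atTop.2 (eventually_of_eventuallyEq_iterLog h)
  have hsmall : ∀ {ε : ℝ}, 0 < ε → ∀ᶠ r : ℝ in 𝓝[>] 0, r < ε := fun hε =>
    mem_nhdsWithin_of_mem_nhds (gt_mem_nhds hε)
  -- The threshold `ρ / (1 + n)` puts the cube of side `R` in the ball, its points having norm at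
  -- most `(1 + n) r`. The last condition is the final bound: half the gap `r ^ (βk)`, times the
  -- volume fraction `r ^ (βn) / (32n)^n`, times `exp(1/r)` from the weight.
  have hall := (tendsto_spikeSide.eventually hφ').and <|
    ((tendsto_const_mul_rpow_neg hα 4 four_pos).eventually hstar).and <|
    ((tendsto_const_mul_rpow_neg hβ 2 two_pos).eventually hstar).and <|
    (hsmall (ε := ρ / (1 + n)) (by positivity)).and <| (hsmall hη).and <|
    (eventually_rpow_le_iterate_log_sub hγ hγβ hC k).and <|
    (tendsto_rpow_mul_exp_one_div (1 / (2 * (32 * n) ^ n)) (β * k + β * n)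
      (by positivity)).eventually_ge_atTop (K : ℝ)
  obtain ⟨j, hφR, hM, hMβ, hrρ, hrη, hgap, hK⟩ := (tendsto_spikeDist.eventually hall).exists
  have hspike := hspike j
  have hup := hup j
  have hr0 := spikeDist_pos j
  have hr8 := spikeDist_le j
  have hσR := spikeRadius_le hβ hr0 (hr8.trans (by norm_num))
  have hσ0 := spikeRadius_pos β hr0
  have hσ_eq : spikeRadius β (spikeDist j) =
      spikeSide (spikeDist j) * spikeDist j ^ β / 32 := rfl
  have hR0 := spikeSide_pos (spikeDist j)
  have hRr := spikeSide_le hr0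
  -- The double exponential in `spikeSide` is chosen for this: one logarithm still leaves an
  -- exponential in `1/r`, which beats all powers of `r`.
  have hRlog : |Real.log (spikeSide (spikeDist j))|⁻¹ = (Real.exp (1 / spikeDist j))⁻¹ := by
    rw [spikeSide, Real.log_exp, abs_neg, Real.abs_exp]
  rw [hRlog] at hφR
  have hnorm_c := norm_spikeCenter i₀ j
  have hc_def : spikeCenter i₀ j = EuclideanSpace.single i₀ (spikeDist j) := rfl
  set c := spikeCenter i₀ j
  set r := spikeDist j
  set σ := spikeRadius β r
  set R := spikeSide r
  -- Displacement `R / 4` keeps the small cube about `c'` inside the cube of side `R`, and its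
  -- `i₀`-coordinates at least `3R/16` from the spike centre, because `σ ≤ R/32`.
  set c' : EuclideanSpace ℝ (Fin n) := EuclideanSpace.single i₀ (r + R / 4) with hc'
  have hσn : σ / n ≤ σ := div_le_self hσ0.le hn
  have hnσ : (n : ℝ) * (σ / n / 2) = σ / 2 := by field_simp
  have hcc' : ∀ i, |c' i - c i| ≤ R / 4 := by
    intro i
    rcases eq_or_ne i i₀ with rfl | hi
    · simp [hc_def, hc', abs_of_nonneg (show 0 ≤ R / 4 by positivity)]
    · simp [hc_def, hc', hi, show 0 ≤ R / 4 by positivity]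
  have hcube_c : ∀ x ∈ cube c (σ / n), 0 < ‖x‖ ∧ ‖x‖ ≤ 2 * r := by
    intro x hx
    have h1 := norm_sub_le_of_mem_cube (by positivity) hx
    have h2 := abs_le.1 (abs_norm_sub_norm_le x c)
    constructor <;> linarith [h2.1, h2.2]
  have hcube_c' : ∀ x ∈ cube c' (σ / n), 3 / 4 * r ≤ ‖x‖ ∧ ‖x‖ ≤ 5 / 4 * r := by
    intro x hx
    have h1 := norm_sub_le_of_mem_cube (by positivity) hx
    have h2 := abs_le.1 (abs_norm_sub_norm_le x c')
    have h3 : ‖c'‖ = r + R / 4 := by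
      rw [hc', PiLp.norm_single, Real.norm_of_nonneg (by positivity)]
    constructor <;> linarith [h2.1, h2.2]
  have hQη : volume (cube c R) < ENNReal.ofReal η := by
    rw [volume_cube]
    refine (pow_le_of_le_one zero_le (ENNReal.ofReal_le_one.2 (by linarith))
      (NeZero.ne n)).trans_lt ?_
    exact (ENNReal.ofReal_lt_ofReal_iff hη).2 (by linarith)
  have hQρ : cube c R ⊆ Metric.ball 0 ρ := by
    intro x hx
    have h1 := norm_sub_le_of_mem_cube hR0.le hx
    have h2 := abs_le.1 (abs_norm_sub_norm_le x c)
    rw [mem_ball_zero_iff]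
    rw [lt_div_iff₀ (by positivity)] at hrρ
    have h3 : (n : ℝ) * (R / 2) ≤ n * r := by gcongr; linarith
    linarith [h2.2]
  refine le_trans ?_ (le_oscSup (s := σ / n) (c₁ := c) (c₂ := c')
    (a := Real.log^[k] (Real.log ((2 * r) ^ (-β))))
    (b := Real.log^[k] (Real.log (C * r ^ (-γ)))) hR0 hQρ hQη ?_ ?_ ?_ ?_)
  · set D := Real.log^[k] (Real.log ((2 * r) ^ (-β))) - Real.log^[k] (Real.log (C * r ^ (-γ)))
    have hE := Real.exp_pos (1 / r)
    calc (K : ℝ≥0∞) = ENNReal.ofReal K := (ENNReal.ofReal_coe_nnreal).symm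
      _ ≤ ENNReal.ofReal (D / 2 * (σ / n) ^ n / R ^ n / (Real.exp (1 / r))⁻¹) := by
          refine ENNReal.ofReal_le_ofReal (hK.trans ?_)
          have hD : r ^ (β * k) / 2 ≤ D / 2 := by linarith
          have hratio : (σ / n) ^ n / R ^ n = r ^ (β * n) / (32 * n) ^ n := by
            rw [← div_pow, Real.rpow_mul_natCast hr0.le, ← div_pow, hσ_eq]
            congr 1
            field_simp
          rw [mul_div_assoc (D / 2), hratio, div_inv_eq_mul]
          refine mul_le_mul_of_nonneg_right ?_ hE.le
          calc 1 / (2 * (32 * (n : ℝ)) ^ n) * r ^ (β * k + β * n)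
              = r ^ (β * k) / 2 * (r ^ (β * n) / (32 * n) ^ n) := by
                rw [Real.rpow_add hr0]; field_simp
            _ ≤ _ := by gcongr
      _ ≤ _ := by
          have hD : 0 ≤ D := le_trans (by positivity) hgap
          rw [ENNReal.ofReal_div_of_pos (by positivity), ENNReal.ofReal_div_of_pos (by positivity),
            ENNReal.ofReal_mul (by positivity), ENNReal.ofReal_pow (by positivity),
            ENNReal.ofReal_pow (by positivity)]
          gcongr
  · exact fun x hx i => (hx i).trans (by linarith)
  · intro x hx i
    have h1 := abs_sub_le (x i) (c' i) (c i)
    linarith [hx i, hcc' i]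
  · intro x hx
    obtain ⟨hx0, hx2⟩ := hcube_c x hx
    have h1 := hspike x hx
    rw [(hMβ _ h1).1]
    exact (hMβ _ le_rfl).2.2.2 _ h1
  · intro x hx
    obtain ⟨hx1, hx2⟩ := hcube_c' x hx
    have hi : c' i₀ - c i₀ = R / 4 := by simp [hc_def, hc']
    have h1 := hup x hx1 hx2 (by
      have h2 := abs_le.1 (hx i₀)
      refine le_trans ?_ (le_abs_self _)
      linarith [h2.1])
    have hxpos : 0 < ‖x‖ := by linarith
    -- An upper bound on `M_δ f` alone would not do: the value must also be large for `φStar` to be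
    -- the iterated logarithm and monotone there.
    have h2 : (4 * r) ^ (-α) ≤ maximal δ f x := by
      refine le_trans ?_ (hlow x hxpos (by linarith))
      exact Real.rpow_le_rpow_of_nonpos (by positivity) (by linarith) (by linarith)
    rw [(hM _ h2).1]
    exact (hM _ h2).2.2.2 _ h1

end Oscillation

end WeightedBMO

/-! ### Choice of the intermediate exponent and conclusion. -/

theorem mainTheorem6 (n : ℕ) (α β : ℝ) (hα : 0 < α) (hαn : α < n) (hαβ : α < β) :
    ∃ f : EuclideanSpace ℝ (Fin n) → ℝ,
      HasCompactSupport f ∧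
      ContDiffOn ℝ 1 f {0}ᶜ ∧
      (∀ p : ℝ, 1 ≤ p → α * p < n → MemLp f (ENNReal.ofReal p) volume) ∧
      (∃ c > 0, ∃ C > 0, ∃ ρ > 0, ∀ x : EuclideanSpace ℝ (Fin n), 0 < ‖x‖ → ‖x‖ < ρ →
        c * ‖x‖ ^ (-α) ≤ |f x| ∧ |f x| ≤ C * ‖x‖ ^ (-β)) ∧
      ∀ δ : ℝ, 0 < δ → δ ≤ 1 → ∀ k : ℕ, 1 ≤ k →
      ∀ φStar φ : ℝ → ℝ,
        φStar =ᶠ[atTop] WeightedBMO.iterLog k →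
        φ =ᶠ[𝓝[>] 0] (fun x => -x * deriv (WeightedBMO.iterLog k) x) →
        (∃ ρ > 0, IntegrableOn (fun x => φStar (WeightedBMO.maximal δ f x))
          (Metric.ball 0 ρ) volume) ∧
        (∀ ρ > 0, ∀ η > 0, WeightedBMO.oscSup φ η (Metric.ball 0 ρ)
          (fun x => φStar (WeightedBMO.maximal δ f x)) = ⊤) ∧
        (∀ η > 0, ¬ WeightedBMO.MemBmo φ η (fun x => φStar (WeightedBMO.maximal δ f x))) := by
  open WeightedBMO in
  have hn0 : n ≠ 0 := by
    rintro rfl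
    norm_num at hαn
    linarith
  have : NeZero n := ⟨hn0⟩
  have hn : (0 : ℝ) < n := by exact_mod_cast NeZero.pos n
  have hβ : 0 < β := hα.trans hαβ
  let i₀ : Fin n := ⟨0, NeZero.pos n⟩
  obtain ⟨f, hcs, hC1, hLp, hbd, hspike⟩ := exists_spiky_power hα hαβ i₀
  have hpos : ∀ x, 0 < ‖x‖ → ‖x‖ < 1 → 0 ≤ f x := fun x h0 h1 =>
    le_trans (by positivity) (hbd x h0 h1).1
  have habs : ∀ x, 0 < ‖x‖ → ‖x‖ < 1 → |f x| ≤ 2 * ‖x‖ ^ (-β) := fun x h0 h1 => by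
    rw [abs_of_nonneg (hpos x h0 h1)]
    exact (hbd x h0 h1).2
  refine ⟨f, hcs, hC1, hLp, ⟨1, one_pos, 2, two_pos, 1, one_pos, fun x h0 h1 => ?_⟩, ?_⟩
  · rw [abs_of_nonneg (hpos x h0 h1), one_mul]
    exact hbd x h0 h1
  intro δ hδ hδ1 k hk φStar φ hStar hφ
  have hL1 : MemLp f 1 volume := by simpa using hLp 1 le_rfl (by linarith)
  obtain ⟨C₁, hC₁, hup⟩ := exists_maximalPow_rpow_le hβ hL1 habs
  -- With `p = n / γ`: `γ > α` puts `f` in `L^p`, `γ < n` gives `p ≥ 1 ≥ δ` for Jensen, and `γ < β`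
  -- leaves a gap to the spike height.
  obtain ⟨γ, hαγ, hγ⟩ := exists_between (lt_min hαβ hαn)
  obtain ⟨hγβ, hγn⟩ := lt_min_iff.1 hγ
  have hγ0 : 0 < γ := hα.trans hαγ
  have hp1 : 1 ≤ n / γ := (one_le_div hγ0).2 hγn.le
  have hαp : α * (n / γ) < n := by
    rw [mul_div_assoc', div_lt_iff₀ hγ0, mul_comm]
    gcongr
  obtain ⟨C₂, hC₂, hupspike⟩ := exists_maximalPow_rpow_le_of_dist_spike (i₀ := i₀) hα hαβ hp1 hαp
    (hLp _ hp1 hαp) habs fun j x h1 h2 h3 => by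
      have hr0 := spikeDist_pos j
      rw [abs_of_nonneg (hpos x (by linarith) (by linarith [spikeDist_le j]))]
      exact (hspike j).2 x h1 h2 h3
  rw [div_div_cancel₀ hn.ne'] at hupspike
  -- Lower bounds pass to the real-valued `maximal` only where the supremum is finite, since
  -- `toReal` sends `⊤` to `0`.
  have hfin : ∀ x, 0 < ‖x‖ → ‖x‖ < 1 / 2 → maximalPow δ f x ^ (1 / δ) ≠ ⊤ := fun x h0 h1 =>
    ((hup δ hδ hδ1 x h0 h1).trans_lt ENNReal.ofReal_lt_top).ne
  have hlow : ∀ x, 0 < ‖x‖ → ‖x‖ < 1 / 2 → (2 * ‖x‖) ^ (-α) ≤ maximal δ f x := fun x h0 h1 =>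
    (ENNReal.ofReal_le_iff_le_toReal (hfin x h0 h1)).1
      (le_maximalPow_rpow_of_norm hα hδ (fun y hy0 hy1 => (hbd y hy0 hy1).1) h0 h1)
  have htop : ∀ ρ > 0, ∀ η > 0, oscSup φ η (Metric.ball 0 ρ)
      (fun x => φStar (maximal δ f x)) = ⊤ := by
    intro ρ hρ η hη
    refine oscSup_eq_top (i₀ := i₀) hα hγ0 hγβ hC₂ hk hStar hφ hlow ?_ ?_ hρ hη
    · intro j x hx
      have hr0 := spikeDist_pos j
      have hr8 := spikeDist_le j
      have hσ0 := spikeRadius_pos β hr0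
      have hσR := spikeRadius_le hβ hr0 (hr8.trans (by norm_num))
      have hRr := spikeSide_le hr0
      have hcube : ∀ y ∈ cube (spikeCenter i₀ j) (spikeRadius β (spikeDist j) / n),
          ‖y - spikeCenter i₀ j‖ ≤ spikeRadius β (spikeDist j) ∧ 0 < ‖y‖ ∧
            ‖y‖ ≤ 2 * spikeDist j := by
        intro y hy
        have h1 := norm_sub_le_of_mem_cube (by positivity) hy
        have h2 : (n : ℝ) * (spikeRadius β (spikeDist j) / n / 2) =
          spikeRadius β (spikeDist j) / 2 := by field_simp
        have h3 := abs_le.1 (abs_norm_sub_norm_le y (spikeCenter i₀ j))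
        rw [norm_spikeCenter] at h3
        refine ⟨by linarith, ?_, ?_⟩ <;> linarith [h3.1, h3.2]
      obtain ⟨-, hx0, hx2⟩ := hcube x hx
      refine (ENNReal.ofReal_le_iff_le_toReal (hfin x hx0 (by linarith))).1
        (ofReal_le_maximalPow_rpow hδ (by positivity) hx fun y hy => ?_)
      obtain ⟨hy1, hy0, hy2⟩ := hcube y hy
      exact (Real.rpow_le_rpow_of_nonpos hy0 hy2 (by linarith)).trans ((hspike j).1 y hy1)
    · intro j x h1 h2 h3
      have hr0 := spikeDist_pos j
      exact ENNReal.toReal_le_of_le_ofReal (by positivity) (hupspike δ hδ hδ1 j x h1 h2 h3)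
  refine ⟨?_, htop, fun η hη hmem => ?_⟩
  · exact integrableOn_comp_maximal (N := β + n) (by positivity) hC₁ hStar hα hlow (by norm_num)
      fun x h0 h1 => ENNReal.toReal_le_of_le_ofReal (by positivity) (hup δ hδ hδ1 x h0 h1)
  · have h1 := oscSup_mono φ η (Set.subset_univ (Metric.ball 0 1))
      (fun x => φStar (maximal δ f x))
    rw [htop 1 one_pos η hη, top_le_iff] at h1
    have h2 := hmem.2
    rw [bmoNorm, h1, add_top] at h2
    exact lt_irrefl _ h2
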